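/- Let $A$ be a finite alphabet, $F_A$ the free group on $A$, and $\widetilde A = A \cup A^{-1}$. For a finitely generated subgroup $K \le F_A$, the Stallings automaton $\mathcal S(K)$ is the automaton over $\widetilde A$ obtained as follows. Write $K=\langle u_1,\dots,u_k\rangle$ with nonempty reduced words $u_i$, glue $k$ closed petals labelled $u_1,\dots,u_k$ (together with the inverse edges) at a basepoint $q_0$, which is the unique initial and the unique terminal state, and successively identify distinct edges with the same origin and the same label, together with their inverse edges, until the automaton is deterministic. Up to isomorphism the result does not depend on the choices made. The transition monoid $M(K)$ is the monoid of all partial transformations of the state set of $\mathcal S(K)$ that are given by reading words of $\widetilde A^*$. Let $\mathbf H$ be a pseudovariety of finite groups, that is, a class of finite groups closed under taking subgroups, homomorphic images and finite direct products, and let $\overline{\mathbf H}$ be the class of all finite monoids all of whose subgroups (subsemigroups that are groups, whose identity need not be that of the monoid) lie in $\mathbf H$. Then $\overline{\mathbf H}$ is stable under every automorphism of $F_A$: for every automorphism $\varphi$ of $F_A$ and every finitely generated subgroup $K \le F_A$, if $M(K) \in \overline{\mathbf H}$, then $M(K\varphi) \in \overline{\mathbf H}$. -/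

import Mathlib

universe u

/-- The set of partial transformations of `Q`; `f q = none` means that `f` is undefined at `q`. -/
def PartialTransformation (Q : Type) : Type := Q → Option Q

/-- Partial transformations act on the right: `q (f g) = (q f) g`. -/
instance (Q : Type) : Monoid (PartialTransformation Q) where
  one := fun q => some q
  mul f g := fun q => (f q).bind g
  one_mul _ := rfl
  mul_one f := funext fun q => Option.bind_fun_some (f q)
  mul_assoc f g h := funext fun q => Option.bind_assoc (f q) g h

/-- A letter of the alphabet of `A` together with its formal inverses: `(a, true)` is `a` and
`(a, false)` is the inverse of `a`. -/
abbrev SignedLetter (A : Type u) : Type u := A × Bool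

/-- The formal inverse of a letter. -/
def SignedLetter.inv {A : Type u} (x : SignedLetter A) : SignedLetter A := (x.1, !x.2)

/-- A finite automaton over the letters of `A` and their inverses with a basepoint, which is
the only initial and the only terminal state. -/
structure BasedAutomaton (A : Type u) where
  State : Type
  finite : Finite State
  Edge : State → SignedLetter A → State → Prop
  base : State

namespace BasedAutomaton

variable {A : Type u}

/-- No state has two distinct outgoing edges with the same label. -/
def IsDeterministic (𝒜 : BasedAutomaton A) : Prop :=
  ∀ p x q r, 𝒜.Edge p x q → 𝒜.Edge p x r → q = r

open Classical in
/-- The partial transformation of the states given by reading one letter (meaningful for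
deterministic automata). -/
noncomputable def delta (𝒜 : BasedAutomaton A) (x : SignedLetter A) :
    PartialTransformation 𝒜.State :=
  fun p => if h : ∃ q, 𝒜.Edge p x q then some h.choose else none

theorem IsDeterministic.delta_eq_some_iff {𝒜 : BasedAutomaton A} (h : 𝒜.IsDeterministic)
    (x : SignedLetter A) (p q : 𝒜.State) : 𝒜.delta x p = some q ↔ 𝒜.Edge p x q := by
  unfold delta
  split_ifs with hx
  · constructor
    · intro e
      exact Option.some.inj e ▸ hx.choose_spec
    · intro e
      exact congrArg some (h p x _ _ hx.choose_spec e)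
  · constructor
    · intro e
      cases e
    · intro e
      exact absurd ⟨q, e⟩ hx

/-- The transition monoid of a deterministic automaton: the image of the homomorphism from the
free monoid of words to the monoid of partial transformations of the states that sends a word to
the partial transformation given by reading it. -/
noncomputable def transitionMonoid (𝒜 : BasedAutomaton A) :
    Submonoid (PartialTransformation 𝒜.State) :=
  MonoidHom.mrange (FreeMonoid.lift 𝒜.delta)

/-- The vertex reached after reading the first `j` letters of the `i`-th petal of the flower with
petals labelled `w 0, …, w (k - 1)`. The vertex `none` is the basepoint, where every petal begins
and ends; the `i`-th petal has `(w i).length - 1` further vertices. -/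
def petalVertex {k : ℕ} (w : Fin k → List (SignedLetter A)) (i : Fin k) (j : ℕ) :
    Option (Σ i : Fin k, Fin ((w i).length - 1)) :=
  if h : 0 < j ∧ j < (w i).length then some ⟨i, ⟨j - 1, by omega⟩⟩ else none

/-- The flower automaton: petals labelled by the words `w 0, …, w (k - 1)` glued at the
basepoint, together with the inverses of all edges. -/
def flower {k : ℕ} (w : Fin k → List (SignedLetter A)) : BasedAutomaton A where
  State := Option (Σ i : Fin k, Fin ((w i).length - 1))
  finite := inferInstance
  Edge p x q := ∃ (i : Fin k) (j : Fin (w i).length),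
    (p = petalVertex w i j ∧ x = (w i).get j ∧ q = petalVertex w i (j + 1)) ∨
    (p = petalVertex w i (j + 1) ∧ x = SignedLetter.inv ((w i).get j) ∧ q = petalVertex w i j)
  base := none

/-- `ℬ` arises (up to isomorphism) from `𝒜` by one folding: there are two distinct edges with
the same origin `p` and the same label `x`, with ends `q ≠ r`, and `ℬ` is the quotient of `𝒜` in
which `q` and `r` are identified, and no other vertices. -/
def Folding (𝒜 ℬ : BasedAutomaton A) : Prop :=
  ∃ (p : 𝒜.State) (x : SignedLetter A) (q r : 𝒜.State),
    𝒜.Edge p x q ∧ 𝒜.Edge p x r ∧ q ≠ r ∧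
    ∃ π : 𝒜.State → ℬ.State, Function.Surjective π ∧
      (∀ s t, π s = π t ↔ s = t ∨ (s = q ∧ t = r) ∨ (s = r ∧ t = q)) ∧
      (∀ s' y t', ℬ.Edge s' y t' ↔ ∃ s t, 𝒜.Edge s y t ∧ π s = s' ∧ π t = t') ∧
      ℬ.base = π 𝒜.base

/-- `𝒜` is a Stallings automaton of the subgroup `K`: it is a deterministic automaton obtained by
a finite sequence of foldings from the flower automaton of a finite family of nonempty reduced
words representing a generating set of `K`. -/
def IsStallings (K : Subgroup (FreeGroup A)) (𝒜 : BasedAutomaton A) : Prop :=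
  ∃ (k : ℕ) (w : Fin k → List (SignedLetter A)),
    (∀ i, w i ≠ [] ∧ FreeGroup.IsReduced (w i)) ∧
    Subgroup.closure (Set.range fun i => FreeGroup.mk (w i)) = K ∧
    Relation.ReflTransGen Folding (flower w) 𝒜 ∧ 𝒜.IsDeterministic

/-- The foldings can be carried out until a deterministic automaton is reached. -/
theorem exists_foldings (𝒜 : BasedAutomaton A) :
    ∃ ℬ : BasedAutomaton A, Relation.ReflTransGen Folding 𝒜 ℬ ∧ ℬ.IsDeterministic := by
  classical
  induction hn : Nat.card 𝒜.State using Nat.strong_induction_on generalizing 𝒜 with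
  | _ n ih =>
    by_cases hd : 𝒜.IsDeterministic
    · exact ⟨𝒜, .refl, hd⟩
    · unfold IsDeterministic at hd
      push Not at hd
      obtain ⟨p, x, q, r, hq, hr, hqr⟩ := hd
      have hfin := 𝒜.finite
      let f : 𝒜.State → {s : 𝒜.State // s ≠ r} := fun s => if h : s = r then ⟨q, hqr⟩ else ⟨s, h⟩
      let ℬ : BasedAutomaton A :=
        { State := {s : 𝒜.State // s ≠ r}
          finite := inferInstance
          Edge := fun s' y t' => ∃ s t, 𝒜.Edge s y t ∧ f s = s' ∧ f t = t'
          base := f 𝒜.base }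
      have hlt : Nat.card ℬ.State < n := hn ▸ Finite.card_subtype_lt (x := r) (by simp)
      obtain ⟨𝒞, h1, h2⟩ := ih _ hlt ℬ rfl
      refine ⟨𝒞, .head ⟨p, x, q, r, hq, hr, hqr, f, ?_, ?_, fun _ _ _ => Iff.rfl, rfl⟩ h1, h2⟩
      · exact fun s => ⟨s.1, dif_neg s.2⟩
      · intro s t
        by_cases hs : s = r <;> by_cases ht : t = r <;> simp [f, hs, ht] <;> grind

/-- Every finitely generated subgroup has a Stallings automaton. -/
theorem exists_isStallings {K : Subgroup (FreeGroup A)} (hK : K.FG) :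
    ∃ 𝒜 : BasedAutomaton A, IsStallings K 𝒜 := by
  classical
  obtain ⟨S, hS⟩ := hK
  let e := (S.erase 1).equivFin
  let w : Fin (S.erase 1).card → List (SignedLetter A) := fun i => (e.symm i).1.toWord
  obtain ⟨𝒜, h1, h2⟩ := exists_foldings (flower w)
  refine ⟨𝒜, _, w, fun i => ⟨?_, FreeGroup.isReduced_toWord⟩, ?_, h1, h2⟩
  · have := Finset.ne_of_mem_erase (e.symm i).2
    simpa [w] using this
  · have : (Set.range fun i => FreeGroup.mk (w i)) = (S : Set (FreeGroup A)) \ {1} := by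
      ext g
      simp only [w, FreeGroup.mk_toWord, Set.mem_range]
      constructor
      · rintro ⟨i, rfl⟩
        have := (e.symm i).2
        simp only [Finset.mem_erase] at this
        exact ⟨this.2, this.1⟩
      · intro hg
        exact ⟨e ⟨g, Finset.mem_erase.2 ⟨hg.2, hg.1⟩⟩, by simp⟩
    rw [this, Subgroup.closure_sdiff_one, hS]

end BasedAutomaton

/-- A class of finite groups is a pseudovariety if it is closed under taking subgroups,
homomorphic images and direct products. -/
structure IsGroupPseudovariety (H : ∀ (G : Type) [Group G], Prop) : Prop where
  finite : ∀ (G : Type) [Group G], H G → Finite G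
  subgroup : ∀ (G : Type) [Group G], H G → ∀ S : Subgroup G, H S
  image : ∀ (G N : Type) [Group G] [Group N] (f : G →* N), Function.Surjective f → H G → H N
  prod : ∀ (G N : Type) [Group G] [Group N], H G → H N → H (G × N)

/-- The class of finite monoids all of whose subgroups lie in `H`. A subgroup of a monoid is a
subsemigroup which is a group; its identity need not be that of the monoid. Thus the subgroups
are, up to isomorphism, the groups with an injective multiplicative map to the monoid. -/
def GroupBar (H : ∀ (G : Type) [Group G], Prop) (M : Type) [Monoid M] : Prop :=
  Finite M ∧ ∀ (G : Type) [Group G] (f : G →ₙ* M), Function.Injective f → H G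

/-- The class `C` of monoids is stable under `φ`: if the transition monoid of the Stallings
automaton of a finitely generated subgroup `K` lies in `C`, so does that of the image of `K`. -/
def IsStableUnder {A : Type u} (C : ∀ (M : Type) [Monoid M], Prop)
    (φ : FreeGroup A ≃* FreeGroup A) : Prop :=
  ∀ K : Subgroup (FreeGroup A), K.FG → ∀ 𝒜 ℬ : BasedAutomaton A,
    BasedAutomaton.IsStallings K 𝒜 → BasedAutomaton.IsStallings (K.map φ.toMonoidHom) ℬ →
      C 𝒜.transitionMonoid → C ℬ.transitionMonoid

/-!
The idea is to express the condition on the transition monoid in terms of the free group alone,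
without a basis. For a subgroup `K` of a group `F` and finitely many distinct right cosets of `K`,
consider the elements of `F` that permute these cosets under right multiplication; they induce a
group of permutations of the cosets, `cosetPermGroup`. For `F` free and `K` finitely generated, all
subgroups of `M(K)` lie in `H` if and only if all these permutation groups lie in `H`
(`Presents.cosetPermGroupsIn` and `Presents.groupBar`). The second condition is visibly preserved
by isomorphisms `F ≃* F'` (`CosetPermGroupsIn.map`), and the theorem follows.

A Stallings automaton is a finite connected subgraph of the Schreier graph of `K` that contains the
coset `K` and all reduced loops at it. These properties are the content of `Presents`: the flower
has them, and foldings preserve them.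

If all subgroups of `M(K)` lie in `H`, then so do the permutation groups of cosets that are states
of the automaton. Indeed, a reduced path of the Schreier graph between two states stays in the
automaton, so such a permutation group is a homomorphic image of a submonoid of `M(K)`, and hence of
a group in this submonoid (`exists_group_surjective_of_finite`). Arbitrary cosets `K gᵢ` with a
nontrivial permutation group can be translated into the automaton. Some `u ≠ 1` fixes all of
them. The states of the automaton correspond to a convex `K`-invariant subset of the Cayley tree
of `F`, which contains the axes of all nontrivial elements of `K`, in particular those of the
elements `gᵢ u gᵢ⁻¹`. If `v⁻¹ u v` is a shortest conjugate of `u`, then `gᵢ v` lies on the axis of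
`gᵢ u gᵢ⁻¹` for every `i` (`FreeGroup.mem_of_norm_le_norm_conj`), so `v` is a translation as required.

Conversely, letters act on the states by partial injections, and so a subgroup of `M(K)` acts
faithfully by permutations on the domain of its identity, which is a finite set of cosets.
-/

/-! ### Groups in finite monoids -/

theorem exists_pow_isIdempotentElem {N : Type*} [Monoid N] [Finite N] (x : N) :
    ∃ m, 0 < m ∧ IsIdempotentElem (x ^ m) := by
  let _ : TopologicalSpace N := ⊥
  have : DiscreteTopology N := ⟨rfl⟩
  obtain ⟨_, ⟨m, hm, rfl⟩, he⟩ := exists_idempotent_in_compact_subsemigroup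
    (fun _ => continuous_of_discreteTopology) {y : N | ∃ m, 0 < m ∧ x ^ m = y}
    ⟨x, 1, one_pos, pow_one x⟩ (Set.toFinite _).isCompact (by
      rintro _ ⟨a, ha, rfl⟩ _ ⟨b, hb, rfl⟩
      exact ⟨a + b, by omega, pow_add x a b⟩)
  exact ⟨m, hm, he⟩

/-- The elements `x` with `e x = x = x e` form a subsemigroup of which `e`, when idempotent, is the
identity. It is a group as soon as each of its elements is left invertible in it. -/
noncomputable abbrev cornerGroup {N : Type*} [Monoid N] (e : N) (he : e * e = e)
    (hinv : ∀ x : N, e * x = x → x * e = x → ∃ y, e * y = y ∧ y * e = y ∧ y * x = e) :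
    Group {x : N // e * x = x ∧ x * e = x} :=
  letI : Mul {x : N // e * x = x ∧ x * e = x} :=
    ⟨fun x y => ⟨x.1 * y.1, by rw [← mul_assoc, x.2.1], by rw [mul_assoc, y.2.2]⟩⟩
  letI : One {x : N // e * x = x ∧ x * e = x} := ⟨⟨e, he, he⟩⟩
  letI : Inv {x : N // e * x = x ∧ x * e = x} :=
    ⟨fun x => ⟨(hinv x.1 x.2.1 x.2.2).choose, (hinv x.1 x.2.1 x.2.2).choose_spec.1,
      (hinv x.1 x.2.1 x.2.2).choose_spec.2.1⟩⟩
  Group.ofLeftAxioms (fun x y z => Subtype.ext (mul_assoc x.1 y.1 z.1)) (fun x => Subtype.ext x.2.1)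
    fun x => Subtype.ext (hinv x.1 x.2.1 x.2.2).choose_spec.2.2

/-- A group that is a homomorphic image of a finite monoid `N` is already a homomorphic image of a
group inside `N`: the group `e N e` for an idempotent `e` with `e N e` as small as possible. -/
theorem exists_group_surjective_of_finite {N Γ : Type} [Monoid N] [Finite N] [Group Γ]
    (π : N →* Γ) (hπ : Function.Surjective π) :
    ∃ (G : Type) (_ : Group G) (ι : G →ₙ* N) (ρ : G →* Γ),
      Function.Injective ι ∧ Function.Surjective ρ ∧ ∀ x, ρ x = π (ι x) := by
  let corner : N → Set N := fun e => {x | e * x = x ∧ x * e = x}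
  obtain ⟨e, he, hmin⟩ := Set.exists_min_image {e : N | e * e = e} (fun e => (corner e).ncard)
    (Set.toFinite _) ⟨1, mul_one 1⟩
  -- by minimality, `e` is the only idempotent of `e N e`
  have huniq : ∀ f : N, f * f = f → e * f = f → f * e = f → f = e := by
    intro f hf h1 h2
    have hsub : corner f ⊆ corner e := by
      rintro x ⟨hx1, hx2⟩
      exact ⟨by rw [← hx1, ← mul_assoc, h1], by rw [← hx2, mul_assoc, h2]⟩
    have heq : corner f = corner e := Set.eq_of_subset_of_ncard_le hsub (hmin f hf)
    have hmem : e ∈ corner f := heq ▸ ⟨he, he⟩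
    exact h2.symm.trans hmem.1
  have hinv : ∀ x : N, e * x = x → x * e = x → ∃ y, e * y = y ∧ y * e = y ∧ y * x = e := by
    intro x h1 h2
    obtain ⟨m, hm, hid⟩ := exists_pow_isIdempotentElem x
    have hl : ∀ k, 0 < k → e * x ^ k = x ^ k ∧ x ^ k * e = x ^ k := by
      intro k hk
      obtain ⟨k, rfl⟩ := Nat.exists_eq_succ_of_ne_zero hk.ne'
      exact ⟨by rw [pow_succ', ← mul_assoc, h1], by rw [pow_succ, mul_assoc, h2]⟩
    have hxm := huniq _ hid (hl m hm).1 (hl m hm).2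
    refine ⟨x ^ (m + m - 1), (hl _ (by omega)).1, (hl _ (by omega)).2, ?_⟩
    rw [← pow_succ, show m + m - 1 + 1 = m + m by omega, pow_add, hxm, he]
  have hπe : π e = 1 := by
    have := congrArg π he
    rwa [map_mul, mul_eq_left] at this
  let _ : Group {x : N // e * x = x ∧ x * e = x} := cornerGroup e he hinv
  have hval : ∀ x y : {x : N // e * x = x ∧ x * e = x}, (x * y).1 = x.1 * y.1 := fun _ _ => rfl
  refine ⟨{x : N // e * x = x ∧ x * e = x}, inferInstance, ⟨Subtype.val, hval⟩,
    MonoidHom.mk' (fun x => π x.1) fun x y => by rw [hval, map_mul],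
    Subtype.val_injective, fun γ => ?_, fun _ => rfl⟩
  obtain ⟨y, rfl⟩ := hπ γ
  refine ⟨⟨e * y * e, ?_, ?_⟩, ?_⟩
  · rw [← mul_assoc, ← mul_assoc, he]
  · rw [mul_assoc, he]
  · simp [hπe]

theorem IsGroupPseudovariety.of_injective {H : ∀ (G : Type) [Group G], Prop}
    (hH : IsGroupPseudovariety H) {G N : Type} [Group G] [Group N] (f : G →* N)
    (hf : Function.Injective f) (hN : H N) : H G :=
  hH.image _ _ (MonoidHom.ofInjective hf).symm.toMonoidHom
    (MonoidHom.ofInjective hf).symm.surjective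
    (hH.subgroup N hN f.range)

/-! ### Permutations of cosets by right multiplication -/

/-- The permutations of a finite family of right cosets `K (g i)` that are given by right
multiplication with an element of the group: `σ` belongs to the group if there is a `w` with
`K (g (σ i)) w = K (g i)` for all `i`. -/
def cosetPermGroup {F ι : Type*} [Group F] (K : Subgroup F) (g : ι → F) :
    Subgroup (Equiv.Perm ι) where
  carrier := {σ | ∃ w, ∀ i, g (σ i) * w * (g i)⁻¹ ∈ K}
  one_mem' := ⟨1, fun i => by simp⟩
  mul_mem' := by
    rintro σ τ ⟨v, hv⟩ ⟨w, hw⟩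
    refine ⟨v * w, fun i => ?_⟩
    have := K.mul_mem (hv (τ i)) (hw i)
    simpa [mul_assoc] using this
  inv_mem' := by
    rintro σ ⟨w, hw⟩
    refine ⟨w⁻¹, fun i => ?_⟩
    have := K.inv_mem (hw (σ⁻¹ i))
    simpa [mul_assoc] using this

section CosetPermGroup

variable {F F' ι : Type*} [Group F] [Group F']

theorem mem_cosetPermGroup {K : Subgroup F} {g : ι → F} {σ : Equiv.Perm ι} :
    σ ∈ cosetPermGroup K g ↔ ∃ w, ∀ i, g (σ i) * w * (g i)⁻¹ ∈ K :=
  Iff.rfl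

theorem cosetPermGroup_mul_right (K : Subgroup F) (g : ι → F) (v : F) :
    cosetPermGroup K (fun i => g i * v) = cosetPermGroup K g := by
  ext σ
  simp only [mem_cosetPermGroup]
  constructor
  · rintro ⟨w, hw⟩
    exact ⟨v * w * v⁻¹, fun i => by simpa [mul_assoc] using hw i⟩
  · rintro ⟨w, hw⟩
    exact ⟨v⁻¹ * w * v, fun i => by simpa [mul_assoc] using hw i⟩

theorem cosetPermGroup_map (φ : F ≃* F') (K : Subgroup F) (g : ι → F') :
    cosetPermGroup (K.map φ.toMonoidHom) g = cosetPermGroup K (fun i => φ.symm (g i)) := by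
  ext σ
  simp only [mem_cosetPermGroup]
  constructor
  · rintro ⟨w, hw⟩
    refine ⟨φ.symm w, fun i => ?_⟩
    have := Subgroup.mem_map_equiv.1 (hw i)
    simpa using this
  · rintro ⟨w, hw⟩
    refine ⟨φ w, fun i => Subgroup.mem_map_equiv.2 ?_⟩
    simpa using hw i

theorem pow_coset_mem {K : Subgroup F} {g : ι → F} {σ : Equiv.Perm ι} {w : F}
    (h : ∀ i, g (σ i) * w * (g i)⁻¹ ∈ K) (n : ℕ) (i : ι) :
    g ((σ ^ n) i) * w ^ n * (g i)⁻¹ ∈ K := by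
  induction n with
  | zero => simp
  | succ n ih =>
    have := K.mul_mem (h ((σ ^ n) i)) ih
    rw [pow_succ' σ, pow_succ' w, Equiv.Perm.mul_apply]
    simpa [mul_assoc] using this

end CosetPermGroup

/-- All groups of permutations that the whole group induces by right multiplication on finite sets
of right cosets of `K` lie in `H`. -/
def CosetPermGroupsIn {F : Type*} [Group F] (H : ∀ (G : Type) [Group G], Prop)
    (K : Subgroup F) : Prop :=
  ∀ (ι : Type) [Finite ι] (g : ι → F), (∀ i j, g i * (g j)⁻¹ ∈ K → i = j) → H (cosetPermGroup K g)

theorem CosetPermGroupsIn.map {F F' : Type*} [Group F] [Group F']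
    {H : ∀ (G : Type) [Group G], Prop} {K : Subgroup F} (h : CosetPermGroupsIn H K)
    (φ : F ≃* F') : CosetPermGroupsIn H (K.map φ.toMonoidHom) := by
  intro ι _ g hg
  rw [cosetPermGroup_map]
  refine h ι _ fun i j hij => hg i j (Subgroup.mem_map_equiv.2 ?_)
  simpa using hij

/-! ### Convex subsets of free groups -/

namespace FreeGroup

variable {A : Type u}

/-- The last vertex in `T` on the path from a vertex in `T` to a vertex outside `T`. -/
theorem exists_exit {T : Set (FreeGroup A)} (L : List (A × Bool)) (hL : IsReduced L)
    {t : FreeGroup A} (ht : t ∈ T) (htL : t * mk L ∉ T) :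
    ∃ t' ∈ T, ∃ x s, IsReduced (x :: s) ∧ t * mk L = t' * mk (x :: s) ∧ t' * mk [x] ∉ T := by
  induction L generalizing t with
  | nil => exact absurd (by simpa [← one_eq_mk] using ht) htL
  | cons x s ih =>
    by_cases hx : t * mk [x] ∈ T
    · have e : t * mk (x :: s) = t * mk [x] * mk s := by
        rw [mul_assoc, mul_mk, List.singleton_append]
      rw [e] at htL ⊢
      exact ih (hL.infix (List.suffix_cons x s).isInfix) hx htL
    · exact ⟨t, ht, x, s, hL, rfl, hx⟩

/-- Let `T` be a convex set of vertices of the Cayley tree, invariant under left multiplication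
with `K`. If `h c h⁻¹ ≠ 1` lies in `K` and `c` is shortest in its conjugacy class, then `h` is on
the axis of `h c h⁻¹`, and this axis lies in `T`. The proof: if `h ∉ T` then the path from `h` to
`h c` first runs to the vertex `t` of `T` closest to `h`, then to `(h c h⁻¹) t`, and then to
`h c`, so that the path from `t` to `(h c h⁻¹) t` is labelled by a shorter conjugate of `c`. -/
theorem mem_of_norm_le_norm_conj [DecidableEq A] {K : Subgroup (FreeGroup A)}
    {T : Set (FreeGroup A)} (hone : 1 ∈ T) (hmul : ∀ k ∈ K, ∀ g ∈ T, k * g ∈ T)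
    (hconv : ∀ g ∈ T, ∀ x L, IsReduced (x :: L) → g * mk (x :: L) ∈ T → g * mk [x] ∈ T)
    {h c : FreeGroup A} (hc : c ≠ 1) (hK : h * c * h⁻¹ ∈ K)
    (hmin : ∀ v, norm c ≤ norm (v * c * v⁻¹)) : h ∈ T := by
  by_contra hT
  obtain ⟨t, ht, x, s, hs, hts, hx⟩ := exists_exit (T := T) h.toWord isReduced_toWord hone
    (by simpa [mk_toWord] using hT)
  rw [one_mul, mk_toWord] at hts
  set k := h * c * h⁻¹ with hk
  set m := t⁻¹ * k * t with hm
  have hcm : c = (mk (x :: s))⁻¹ * m * mk (x :: s) := by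
    rw [hm, hk, hts]; group
  have hm1 : m ≠ 1 := by
    intro h1
    exact hc (by rw [hcm, h1]; group)
  have hkt : k * t ∈ T := hmul k hK t ht
  have htm : t * m = k * t := by rw [hm]; group
  have hred : IsReduced (invRev (x :: s) ++ m.toWord ++ (x :: s)) := by
    have hmr : IsReduced m.toWord := isReduced_toWord
    have hinv : IsReduced (invRev (x :: s)) := by
      rw [isReduced_iff_reduce_eq, reduce_invRev, hs.reduce_eq]
    have hmne : m.toWord ≠ [] := by simpa using hm1
    -- no cancellation at the left end of `m`
    have h1 : ∀ y ∈ m.toWord.head?, y ≠ x := by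
      rintro y hy rfl
      obtain ⟨l, hl⟩ := List.head?_eq_some_iff.1 hy
      refine hx (hconv t ht y l (hl ▸ hmr) ?_)
      rwa [← hl, mk_toWord, htm]
    -- no cancellation at the right end of `m`
    have h2 : ∀ z ∈ m.toWord.getLast?, z.1 = x.1 → z.2 = x.2 := by
      intro z hz hz1
      by_contra hz2
      obtain ⟨l, hl⟩ := List.getLast?_eq_some_iff.1 hz
      have hzx : invRev [z] = [x] := by
        have : (z.1, !z.2) = x := Prod.ext hz1 (by simpa using Bool.not_eq.2 hz2)
        simpa [invRev] using this
      have hinvm : invRev m.toWord = x :: invRev l := by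
        rw [hl, invRev_append, hzx, List.singleton_append]
      have hr : IsReduced (x :: invRev l) := by
        rw [← hinvm, ← toWord_inv]; exact isReduced_toWord
      have hmem := hconv (k * t) hkt x (invRev l) hr (by
        rw [← hinvm, ← toWord_inv, mk_toWord, ← htm, mul_inv_cancel_right]; exact ht)
      refine hx ?_
      have := hmul k⁻¹ (K.inv_mem hK) _ hmem
      simpa [mul_assoc] using this
    refine List.isChain_append.2 ⟨List.isChain_append.2 ⟨hinv, hmr, ?_⟩, hs, ?_⟩
    · intro a ha y hy hay
      rw [invRev_cons] at ha
      have : a = (x.1, !x.2) := by simpa [invRev, eq_comm] using ha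
      subst this
      by_contra hne
      exact h1 y hy (Prod.ext hay.symm (by simpa using Bool.not_eq.2 (Ne.symm hne)))
    · intro z hz y hy hzy
      rw [List.getLast?_append_of_ne_nil _ hmne] at hz
      have : y = x := by simpa [eq_comm] using hy
      subst this
      exact h2 z hz hzy
  have hcw : c.toWord = invRev (x :: s) ++ m.toWord ++ (x :: s) := by
    rw [← hred.reduce_eq, ← toWord_mk, ← mul_mk, ← mul_mk, ← inv_mk, mk_toWord, ← hcm]
  have hle := hmin (mk (x :: s))
  have hmc : mk (x :: s) * c * (mk (x :: s))⁻¹ = m := by rw [hcm]; group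
  rw [hmc, norm, norm, hcw] at hle
  simp at hle
  omega

end FreeGroup

/-! ### Paths in automata -/

namespace BasedAutomaton

variable {A : Type u}

/-- There is a path from `p` to `q` labelled by the word `L`. -/
def Path (𝒜 : BasedAutomaton A) : 𝒜.State → List (SignedLetter A) → 𝒜.State → Prop
  | p, [], q => p = q
  | p, x :: L, q => ∃ r, 𝒜.Edge p x r ∧ 𝒜.Path r L q

variable {𝒜 ℬ : BasedAutomaton A} {K : Subgroup (FreeGroup A)}

theorem path_append {L M : List (SignedLetter A)} {p q : 𝒜.State} :
    𝒜.Path p (L ++ M) q ↔ ∃ r, 𝒜.Path p L r ∧ 𝒜.Path r M q := by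
  induction L generalizing p with
  | nil => simp [Path]
  | cons x L ih =>
    simp only [List.cons_append, Path, ih]
    exact ⟨fun ⟨r, h, s, h1, h2⟩ => ⟨s, ⟨r, h, h1⟩, h2⟩,
      fun ⟨s, ⟨r, h, h1⟩, h2⟩ => ⟨r, h, s, h1, h2⟩⟩

theorem path_singleton {x : SignedLetter A} {p q : 𝒜.State} : 𝒜.Path p [x] q ↔ 𝒜.Edge p x q := by
  simp [Path]

/-- The properties of an automaton that make it, once deterministic, a finite connected subgraph of
the Schreier graph of `K` that contains the vertex `K` and in which all elements of `K` label loops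
at that vertex. In `sound`, `v p` represents the right coset of `K` that corresponds to the
state `p`. -/
structure Presents (𝒜 : BasedAutomaton A) (K : Subgroup (FreeGroup A)) : Prop where
  edge_inv : ∀ p x q, 𝒜.Edge p x q → 𝒜.Edge q (SignedLetter.inv x) p
  connected : ∀ q, ∃ L, 𝒜.Path 𝒜.base L q
  sound : ∃ v : 𝒜.State → FreeGroup A, v 𝒜.base ∈ K ∧
    ∀ p x q, 𝒜.Edge p x q → v p * FreeGroup.mk [x] * (v q)⁻¹ ∈ K
  complete : ∀ g ∈ K, ∃ L, FreeGroup.mk L = g ∧ 𝒜.Path 𝒜.base L 𝒜.base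

theorem path_invRev (hinv : ∀ p x q, 𝒜.Edge p x q → 𝒜.Edge q (SignedLetter.inv x) p)
    {L : List (SignedLetter A)} {p q : 𝒜.State} (h : 𝒜.Path p L q) :
    𝒜.Path q (FreeGroup.invRev L) p := by
  induction L generalizing p with
  | nil => exact Eq.symm h
  | cons x L ih =>
    obtain ⟨r, h1, h2⟩ := h
    rw [FreeGroup.invRev_cons, path_append]
    exact ⟨r, ih h2, path_singleton.2 (hinv _ _ _ h1)⟩

/-! ### Stallings automata present their subgroups -/

theorem petalVertex_zero {k : ℕ} (w : Fin k → List (SignedLetter A)) (i : Fin k) :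
    petalVertex w i 0 = none := by
  simp [petalVertex]

theorem petalVertex_length {k : ℕ} (w : Fin k → List (SignedLetter A)) (i : Fin k) :
    petalVertex w i (w i).length = none := by
  simp [petalVertex]

theorem path_petal {k : ℕ} (w : Fin k → List (SignedLetter A)) (i : Fin k) (j : ℕ)
    (hj : j ≤ (w i).length) : (flower w).Path none ((w i).take j) (petalVertex w i j) := by
  induction j with
  | zero => exact (petalVertex_zero w i).symm
  | succ j ih =>
    rw [← List.take_concat_get' _ _ (by omega)]
    exact path_append.2 ⟨_, ih (by omega),
      path_singleton.2 ⟨i, ⟨j, by omega⟩, Or.inl ⟨rfl, rfl, rfl⟩⟩⟩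

theorem flower_presents {k : ℕ} (w : Fin k → List (SignedLetter A)) :
    (flower w).Presents (Subgroup.closure (Set.range fun i => FreeGroup.mk (w i))) := by
  have hinv : ∀ p x q, (flower w).Edge p x q → (flower w).Edge q (SignedLetter.inv x) p := by
    rintro p x q ⟨i, j, ⟨hp, hx, hq⟩ | ⟨hp, hx, hq⟩⟩
    · exact ⟨i, j, Or.inr ⟨hq, by rw [hx], hp⟩⟩
    · exact ⟨i, j, Or.inl ⟨hq, by rw [hx]; simp [SignedLetter.inv], hp⟩⟩
  refine ⟨hinv, ?_, ?_, ?_⟩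
  · rintro (_ | ⟨i, j⟩)
    · exact ⟨[], rfl⟩
    · refine ⟨(w i).take (j + 1), ?_⟩
      have := path_petal w i (j + 1) (by omega)
      rwa [petalVertex, dif_pos (by omega)] at this
  · let v : (flower w).State → FreeGroup A
      | none => 1
      | some ⟨i, j⟩ => FreeGroup.mk ((w i).take (j + 1))
    have hgen : ∀ i, FreeGroup.mk (w i) ∈
        Subgroup.closure (Set.range fun i => FreeGroup.mk (w i)) :=
      fun i => Subgroup.subset_closure ⟨i, rfl⟩
    have hv : ∀ i j, j ≤ (w i).length → FreeGroup.mk ((w i).take j) * (v (petalVertex w i j))⁻¹ ∈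
        Subgroup.closure (Set.range fun i => FreeGroup.mk (w i)) := by
      intro i j hj
      by_cases h : 0 < j ∧ j < (w i).length
      · rw [petalVertex, dif_pos h]
        simp [v, Nat.sub_add_cancel h.1, -FreeGroup.inv_mk]
      · rw [petalVertex, dif_neg h]
        obtain rfl | rfl : j = 0 ∨ j = (w i).length := by omega
        · simp [v, ← FreeGroup.one_eq_mk]
        · simpa [v] using hgen i
    have hedge : ∀ i (j : Fin (w i).length), v (petalVertex w i j) * FreeGroup.mk [(w i).get j] *
        (v (petalVertex w i (j + 1)))⁻¹ ∈
          Subgroup.closure (Set.range fun i => FreeGroup.mk (w i)) := by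
      intro i j
      have h1 := hv i j (by omega)
      have h2 := hv i (j + 1) (by omega)
      rw [← List.take_concat_get' _ _ j.2, ← FreeGroup.mul_mk] at h2
      simpa [mul_assoc, -FreeGroup.inv_mk, -FreeGroup.mul_mk] using
        Subgroup.mul_mem _ (Subgroup.inv_mem _ h1) h2
    refine ⟨v, one_mem _, ?_⟩
    rintro p x q ⟨i, j, ⟨rfl, rfl, rfl⟩ | ⟨rfl, rfl, rfl⟩⟩
    · exact hedge i j
    · have e : FreeGroup.mk [SignedLetter.inv ((w i).get j)] = (FreeGroup.mk [(w i).get j])⁻¹ := by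
        simp [FreeGroup.inv_mk, FreeGroup.invRev, SignedLetter.inv]
      have := Subgroup.inv_mem _ (hedge i j)
      rw [e]
      simpa [mul_assoc] using this
  · intro g hg
    induction hg using Subgroup.closure_induction with
    | mem g hg =>
      obtain ⟨i, rfl⟩ := hg
      refine ⟨w i, rfl, ?_⟩
      have := path_petal w i _ le_rfl
      rwa [List.take_length, petalVertex_length] at this
    | one => exact ⟨[], rfl, rfl⟩
    | mul g h _ _ hg hh =>
      obtain ⟨L, rfl, hL⟩ := hg
      obtain ⟨M, rfl, hM⟩ := hh
      exact ⟨L ++ M, FreeGroup.mul_mk.symm, path_append.2 ⟨_, hL, hM⟩⟩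
    | inv g _ hg =>
      obtain ⟨L, rfl, hL⟩ := hg
      exact ⟨_, FreeGroup.inv_mk.symm, path_invRev hinv hL⟩

theorem Presents.folding (h : 𝒜.Presents K) (hf : Folding 𝒜 ℬ) : ℬ.Presents K := by
  obtain ⟨p, x, q, r, hq, hr, -, π, hsurj, hπ, hedge, hbase⟩ := hf
  have hpath : ∀ L s t, 𝒜.Path s L t → ℬ.Path (π s) L (π t) := by
    intro L
    induction L with
    | nil => rintro s t rfl; rfl
    | cons y L ih =>
      rintro s t ⟨s', h1, h2⟩
      exact ⟨π s', (hedge _ _ _).2 ⟨s, s', h1, rfl, rfl⟩, ih _ _ h2⟩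
  refine ⟨?_, ?_, ?_, ?_⟩
  · intro s' y t' hst
    obtain ⟨s, t, h1, rfl, rfl⟩ := (hedge _ _ _).1 hst
    exact (hedge _ _ _).2 ⟨t, s, h.edge_inv _ _ _ h1, rfl, rfl⟩
  · intro t'
    obtain ⟨t, rfl⟩ := hsurj t'
    obtain ⟨L, hL⟩ := h.connected t
    exact ⟨L, hbase ▸ hpath _ _ _ hL⟩
  · obtain ⟨v, hv, hve⟩ := h.sound
    -- the two identified states represent the same coset `K (v p) x`
    have hqr : v q * (v r)⁻¹ ∈ K := by
      simpa [mul_assoc, -FreeGroup.inv_mk] using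
        K.mul_mem (K.inv_mem (hve _ _ _ hq)) (hve _ _ _ hr)
    have hcoset : ∀ s t, π s = π t → v s * (v t)⁻¹ ∈ K := by
      intro s t hst
      obtain rfl | ⟨rfl, rfl⟩ | ⟨rfl, rfl⟩ := (hπ s t).1 hst
      · simp
      · exact hqr
      · simpa using K.inv_mem hqr
    have hsec : ∀ s, v (Function.surjInv hsurj (π s)) * (v s)⁻¹ ∈ K :=
      fun s => hcoset _ _ (Function.surjInv_eq hsurj _)
    refine ⟨fun s' => v (Function.surjInv hsurj s'), ?_, ?_⟩
    · have := K.mul_mem (hsec 𝒜.base) hv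
      rw [hbase]
      simpa using this
    · intro s' y t' hst
      obtain ⟨s, t, h1, rfl, rfl⟩ := (hedge _ _ _).1 hst
      have := K.mul_mem (K.mul_mem (hsec s) (hve _ _ _ h1)) (K.inv_mem (hsec t))
      simpa [mul_assoc] using this
  · intro g hg
    obtain ⟨L, rfl, hL⟩ := h.complete g hg
    exact ⟨L, rfl, hbase ▸ hpath _ _ _ hL⟩

theorem IsStallings.presents (h : IsStallings K 𝒜) : 𝒜.Presents K := by
  obtain ⟨k, w, -, rfl, hf, -⟩ := h
  induction hf with
  | refl => exact flower_presents w
  | tail _ hf ih => exact ih.folding hf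

theorem IsStallings.isDeterministic (h : IsStallings K 𝒜) : 𝒜.IsDeterministic := by
  obtain ⟨_, _, _, _, _, h⟩ := h
  exact h

/-! ### The partial action of the free group on a deterministic automaton -/

theorem IsDeterministic.path_unique (hd : 𝒜.IsDeterministic) {L : List (SignedLetter A)}
    {p q r : 𝒜.State} (hq : 𝒜.Path p L q) (hr : 𝒜.Path p L r) : q = r := by
  induction L generalizing p with
  | nil => exact hq.symm.trans hr
  | cons x L ih =>
    obtain ⟨s, h1, h2⟩ := hq
    obtain ⟨t, h3, h4⟩ := hr
    obtain rfl := hd _ _ _ _ h1 h3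
    exact ih h2 h4

theorem IsDeterministic.path_red (hd : 𝒜.IsDeterministic)
    (hinv : ∀ p x q, 𝒜.Edge p x q → 𝒜.Edge q (SignedLetter.inv x) p)
    {L M : List (SignedLetter A)} (h : FreeGroup.Red L M) {p q : 𝒜.State} (hL : 𝒜.Path p L q) :
    𝒜.Path p M q := by
  induction h with
  | refl => exact hL
  | tail _ hs ih =>
    cases hs with
    | @not L₁ L₂ a b =>
      obtain ⟨r, h1, s, h2, t, h3, h4⟩ := path_append.1 ih
      -- reading a letter and then its inverse leads back to the same state
      obtain rfl := hd _ _ _ _ (hinv _ _ _ h2) h3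
      exact path_append.2 ⟨r, h1, h4⟩

/-- The element `g` of the free group can be read from `p` to `q`, that is, some word that
represents `g` labels a path from `p` to `q`. In a deterministic automaton with inverse edges the
reduced word then does so as well. -/
def Reads (𝒜 : BasedAutomaton A) (p : 𝒜.State) (g : FreeGroup A) (q : 𝒜.State) : Prop :=
  ∃ L, FreeGroup.mk L = g ∧ 𝒜.Path p L q

theorem reads_one (p : 𝒜.State) : 𝒜.Reads p 1 p :=
  ⟨[], rfl, rfl⟩

theorem Reads.mul {p q r : 𝒜.State} {g h : FreeGroup A} (hg : 𝒜.Reads p g q)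
    (hh : 𝒜.Reads q h r) : 𝒜.Reads p (g * h) r := by
  obtain ⟨L, rfl, hL⟩ := hg
  obtain ⟨M, rfl, hM⟩ := hh
  exact ⟨L ++ M, FreeGroup.mul_mk.symm, path_append.2 ⟨q, hL, hM⟩⟩

namespace Presents

variable (h𝒜 : 𝒜.Presents K)
include h𝒜

theorem reads_inv {p q : 𝒜.State} {g : FreeGroup A} (hg : 𝒜.Reads p g q) :
    𝒜.Reads q g⁻¹ p := by
  obtain ⟨L, rfl, hL⟩ := hg
  exact ⟨_, FreeGroup.inv_mk.symm, path_invRev h𝒜.edge_inv hL⟩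

theorem path_toWord [DecidableEq A] (hd : 𝒜.IsDeterministic) {p q : 𝒜.State} {g : FreeGroup A}
    (hg : 𝒜.Reads p g q) : 𝒜.Path p g.toWord q := by
  obtain ⟨L, rfl, hL⟩ := hg
  rw [FreeGroup.toWord_mk]
  exact hd.path_red h𝒜.edge_inv FreeGroup.reduce.red hL

theorem reads_unique (hd : 𝒜.IsDeterministic) {p q r : 𝒜.State} {g : FreeGroup A}
    (hq : 𝒜.Reads p g q) (hr : 𝒜.Reads p g r) : q = r := by
  classical
  exact hd.path_unique (h𝒜.path_toWord hd hq) (h𝒜.path_toWord hd hr)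

theorem reads_base_iff {g : FreeGroup A} : 𝒜.Reads 𝒜.base g 𝒜.base ↔ g ∈ K := by
  refine ⟨?_, h𝒜.complete g⟩
  rintro ⟨L, rfl, hL⟩
  obtain ⟨v, hv, hve⟩ := h𝒜.sound
  have key : ∀ L p q, 𝒜.Path p L q → v p * FreeGroup.mk L * (v q)⁻¹ ∈ K := by
    intro L
    induction L with
    | nil => rintro p q rfl; simp [← FreeGroup.one_eq_mk]
    | cons x L ih =>
      rintro p q ⟨r, h1, h2⟩
      have := K.mul_mem (hve _ _ _ h1) (ih _ _ h2)
      rw [← List.singleton_append, ← FreeGroup.mul_mk]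
      simpa [mul_assoc, -FreeGroup.mul_mk] using this
  have := K.mul_mem (K.mul_mem (K.inv_mem hv) (key _ _ _ hL)) hv
  simpa [mul_assoc] using this

/-- If `g i` leads from the basepoint to `q i`, then the action of the free group on the cosets
`K (g i)` is its partial action on the states `q i`. -/
theorem reads_iff_coset {g g' w : FreeGroup A} {q q' : 𝒜.State}
    (hg : 𝒜.Reads 𝒜.base g q) (hg' : 𝒜.Reads 𝒜.base g' q') :
    𝒜.Reads q w q' ↔ g * w * g'⁻¹ ∈ K := by
  rw [← h𝒜.reads_base_iff]
  constructor
  · intro hw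
    exact (hg.mul hw).mul (h𝒜.reads_inv hg')
  · intro hw
    have := ((h𝒜.reads_inv hg).mul hw).mul hg'
    simpa [mul_assoc] using this

/-- A family of vertices of the Schreier graph with a nontrivial group of induced permutations can
be moved into the Stallings automaton by a common translation: some element of the free group
fixes all of the cosets, and its axis in the Cayley tree does the job. -/
theorem exists_translate (hd : 𝒜.IsDeterministic) {ι : Type} [Finite ι] {g : ι → FreeGroup A}
    (hg : ∀ i j, g i * (g j)⁻¹ ∈ K → i = j) {σ : Equiv.Perm ι} (hσ : σ ∈ cosetPermGroup K g)
    (hσ1 : σ ≠ 1) : ∃ v, ∀ i, ∃ q, 𝒜.Reads 𝒜.base (g i * v) q := by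
  classical
  obtain ⟨w, hw⟩ := hσ
  have hw1 : w ≠ 1 := by
    rintro rfl
    exact hσ1 (Equiv.ext fun i => hg _ _ (by simpa using hw i))
  have hn := orderOf_pos σ
  have hu : ∀ i, g i * w ^ orderOf σ * (g i)⁻¹ ∈ K := by
    intro i
    have := pow_coset_mem hw (orderOf σ) i
    rwa [pow_orderOf_eq_one] at this
  have hu1 : w ^ orderOf σ ≠ 1 := fun h => hw1 ((pow_eq_one_iff_left hn.ne').1 h)
  generalize w ^ orderOf σ = u at hu hu1
  -- conjugate `u` to an element of least length
  obtain ⟨v, hv⟩ : ∃ v, ∀ v', (v⁻¹ * u * v).norm ≤ (v'⁻¹ * u * v').norm :=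
    ⟨_, fun v' => Function.argmin_le (fun v => (v⁻¹ * u * v).norm) v'⟩
  refine ⟨v, fun i => ?_⟩
  refine FreeGroup.mem_of_norm_le_norm_conj (K := K) (T := {x | ∃ q, 𝒜.Reads 𝒜.base x q})
    ⟨_, reads_one _⟩ ?_ ?_ (c := v⁻¹ * u * v) ?_ ?_ ?_
  · rintro k hk x ⟨q, hq⟩
    exact ⟨q, (h𝒜.reads_base_iff.2 hk).mul hq⟩
  · rintro x ⟨q, hq⟩ y L hL ⟨r, hr⟩
    have hyL : 𝒜.Reads q (FreeGroup.mk (y :: L)) r := by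
      simpa using (h𝒜.reads_inv hq).mul hr
    have hp := h𝒜.path_toWord hd hyL
    rw [FreeGroup.toWord_mk, hL.reduce_eq] at hp
    obtain ⟨s, hs, -⟩ := hp
    exact ⟨s, hq.mul ⟨[y], rfl, path_singleton.2 hs⟩⟩
  · intro h1
    refine hu1 ?_
    have : u = v * (v⁻¹ * u * v) * v⁻¹ := by group
    rw [this, h1]; group
  · have : g i * v * (v⁻¹ * u * v) * (g i * v)⁻¹ = g i * u * (g i)⁻¹ := by group
    rw [this]
    exact hu i
  · intro s
    have : s * (v⁻¹ * u * v) * s⁻¹ = (v * s⁻¹)⁻¹ * u * (v * s⁻¹) := by group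
    rw [this]
    exact hv _

end Presents

/-! ### Subgroups of the transition monoid -/

theorem _root_.PartialTransformation.mul_apply_of_eq_some {Q : Type}
    {f g : PartialTransformation Q} {p q : Q} (h : f p = some q) : (f * g) p = g q :=
  congrArg (fun r : Option Q => r.bind g) h

theorem IsDeterministic.lift_delta_eq_some_iff (hd : 𝒜.IsDeterministic)
    (L : List (SignedLetter A)) (p q : 𝒜.State) :
    FreeMonoid.lift 𝒜.delta (FreeMonoid.ofList L) p = some q ↔ 𝒜.Path p L q := by
  induction L generalizing p with
  | nil => exact Option.some_inj
  | cons x L ih =>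
    rw [FreeMonoid.ofList_cons, map_mul, FreeMonoid.lift_eval_of]
    refine Option.bind_eq_some_iff.trans ?_
    exact exists_congr fun r => and_congr (hd.delta_eq_some_iff x p r) (ih r)

theorem IsDeterministic.exists_path_of_mem (hd : 𝒜.IsDeterministic)
    {f : PartialTransformation 𝒜.State} (hf : f ∈ 𝒜.transitionMonoid) :
    ∃ L, ∀ p q, f p = some q ↔ 𝒜.Path p L q := by
  obtain ⟨L, rfl⟩ := hf
  exact ⟨L.toList, hd.lift_delta_eq_some_iff L.toList⟩

theorem Presents.exists_mem_transitionMonoid (h𝒜 : 𝒜.Presents K) (hd : 𝒜.IsDeterministic)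
    (w : FreeGroup A) : ∃ f ∈ 𝒜.transitionMonoid, ∀ p q, 𝒜.Reads p w q → f p = some q := by
  classical
  exact ⟨_, ⟨FreeMonoid.ofList w.toWord, rfl⟩,
    fun p q h => (hd.lift_delta_eq_some_iff _ p q).2 (h𝒜.path_toWord hd h)⟩

theorem Presents.injOn_of_mem_transitionMonoid (h𝒜 : 𝒜.Presents K) (hd : 𝒜.IsDeterministic)
    {f : PartialTransformation 𝒜.State} (hf : f ∈ 𝒜.transitionMonoid) {p p' q : 𝒜.State}
    (hp : f p = some q) (hp' : f p' = some q) : p = p' := by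
  obtain ⟨L, hL⟩ := hd.exists_path_of_mem hf
  exact hd.path_unique (path_invRev h𝒜.edge_inv ((hL _ _).1 hp))
    (path_invRev h𝒜.edge_inv ((hL _ _).1 hp'))

/-- The pairs of an element of the transition monoid and a permutation `σ` of the index set of a
family `q` of states such that the former maps `q (σ i)` to `q i`. -/
def permPairs {ι : Type} (𝒜 : BasedAutomaton A) (q : ι → 𝒜.State) :
    Submonoid (𝒜.transitionMonoid × Equiv.Perm ι) where
  carrier := {x | ∀ i, x.1.1 (q (x.2 i)) = some (q i)}
  one_mem' _ := rfl
  mul_mem' := by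
    intro x y hx hy i
    exact (PartialTransformation.mul_apply_of_eq_some (hx (y.2 i))).trans (hy i)

/-- The groups of induced permutations of finitely many states of the automaton lie in `H` if the
subgroups of the transition monoid do. -/
theorem Presents.cosetPermGroup_of_reads {H : ∀ (G : Type) [Group G], Prop}
    (hH : IsGroupPseudovariety H) (h𝒜 : 𝒜.Presents K) (hd : 𝒜.IsDeterministic)
    (hM : GroupBar H 𝒜.transitionMonoid) {ι : Type} [Finite ι] {g : ι → FreeGroup A}
    (hg : ∀ i j, g i * (g j)⁻¹ ∈ K → i = j) {q : ι → 𝒜.State}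
    (hq : ∀ i, 𝒜.Reads 𝒜.base (g i) (q i)) : H (cosetPermGroup K g) := by
  have := hM.1
  have hqinj : Function.Injective q := by
    intro i j hij
    refine hg i j ?_
    rw [← h𝒜.reads_base_iff]
    exact (hq i).mul (hij ▸ h𝒜.reads_inv (hq j))
  -- an element of the transition monoid that permutes the states induces an element of the group
  have hmem : ∀ x ∈ 𝒜.permPairs q, x.2 ∈ cosetPermGroup K g := by
    intro x hx
    obtain ⟨L, hL⟩ := hd.exists_path_of_mem x.1.2
    exact ⟨FreeGroup.mk L, fun i => (h𝒜.reads_iff_coset (hq (x.2 i)) (hq i)).1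
      ⟨L, rfl, (hL _ _).1 (hx i)⟩⟩
  let π : 𝒜.permPairs q →* cosetPermGroup K g :=
    { toFun := fun x => ⟨x.1.2, hmem x.1 x.2⟩
      map_one' := rfl
      map_mul' := fun _ _ => rfl }
  have hπ : Function.Surjective π := by
    rintro ⟨σ, w, hw⟩
    obtain ⟨f, hf, hfw⟩ := h𝒜.exists_mem_transitionMonoid hd w
    exact ⟨⟨(⟨f, hf⟩, σ), fun i =>
      hfw _ _ ((h𝒜.reads_iff_coset (hq (σ i)) (hq i)).2 (hw i))⟩, rfl⟩
  obtain ⟨G, _, f, ρ, hf, hρ, -⟩ := exists_group_surjective_of_finite π hπ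
  refine hH.image G _ ρ hρ (hM.2 G ⟨fun x => (f x).1.1, fun x y => by simp⟩ fun x y hxy => hf ?_)
  have hxy1 : (f x).1.1 = (f y).1.1 := hxy
  refine Subtype.ext (Prod.ext hxy1 (Equiv.ext fun i => hqinj ?_))
  have h2 := (f y).2 i
  rw [← hxy1] at h2
  -- both permutations are determined by the partial transformation, read backwards
  have h1 : ∀ j, (f x).1.1.1 (q ((f x).1.2 j)) = some (q j) := (f x).2
  exact h𝒜.injOn_of_mem_transitionMonoid hd (f x).1.1.2 (h1 i) h2

theorem Presents.cosetPermGroupsIn {H : ∀ (G : Type) [Group G], Prop}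
    (hH : IsGroupPseudovariety H) (h𝒜 : 𝒜.Presents K) (hd : 𝒜.IsDeterministic)
    (hM : GroupBar H 𝒜.transitionMonoid) : CosetPermGroupsIn H K := by
  intro ι _ g hg
  by_cases htriv : ∃ σ ∈ cosetPermGroup K g, σ ≠ 1
  · obtain ⟨σ, hσ, hσ1⟩ := htriv
    obtain ⟨v, hv⟩ := h𝒜.exists_translate hd hg hσ hσ1
    choose q hq using hv
    rw [← cosetPermGroup_mul_right K g v]
    exact h𝒜.cosetPermGroup_of_reads hH hd hM (fun i j hij => hg i j (by simpa using hij)) hq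
  · push Not at htriv
    have hunit : H Unit := hM.2 Unit ⟨fun _ => 1, fun _ _ => (one_mul 1).symm⟩ fun _ _ _ => rfl
    exact hH.image Unit _ 1 (fun x => ⟨(), (Subtype.ext (htriv x.1 x.2)).symm⟩) hunit

/-- A subgroup of the transition monoid acts faithfully by permutations on the domain of its
identity, a finite set of states, that is, of cosets of `K`. -/
theorem Presents.groupBar {H : ∀ (G : Type) [Group G], Prop} (hH : IsGroupPseudovariety H)
    (h𝒜 : 𝒜.Presents K) (hd : 𝒜.IsDeterministic) (hK : CosetPermGroupsIn H K) :
    GroupBar H 𝒜.transitionMonoid := by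
  have := 𝒜.finite
  have hfin : Finite (PartialTransformation 𝒜.State) :=
    inferInstanceAs (Finite (𝒜.State → Option 𝒜.State))
  refine ⟨inferInstance, fun G _ f hf => ?_⟩
  have hmul : ∀ x y p, (f (x * y)).1 p = ((f x).1 p).bind (f y).1 := by
    intro x y p
    rw [map_mul]; rfl
  let X := {p : 𝒜.State // (f 1).1 p = some p}
  -- the idempotent `f 1` is the identity on its image, hence, being injective, on its domain
  have hfix : ∀ p p', (f 1).1 p = some p' → (f 1).1 p' = some p' := by
    intro p p' h
    have := hmul 1 1 p
    rw [mul_one, h] at this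
    exact this.symm
  have hdom : ∀ p p', (f 1).1 p = some p' → (f 1).1 p = some p := by
    intro p p' h
    have := h𝒜.injOn_of_mem_transitionMonoid hd (f 1).2 h (hfix p p' h)
    rwa [← this] at h
  have himg : ∀ x p p', (f x).1 p = some p' → (f 1).1 p' = some p' := by
    intro x p p' h
    have := hmul x 1 p
    rw [mul_one, h] at this
    exact this.symm
  have htot : ∀ x (p : X), ∃ p' : X, (f x).1 p.1 = some p'.1 := by
    intro x p
    have := hmul x x⁻¹ p.1
    rw [mul_inv_cancel, p.2] at this
    obtain ⟨p', h1, -⟩ := Option.bind_eq_some_iff.1 this.symm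
    exact ⟨⟨p', himg _ _ _ h1⟩, h1⟩
  choose a ha using htot
  have ha_eq : ∀ x (p p' : X), (f x).1 p.1 = some p'.1 → a x p = p' := fun x p p' h =>
    Subtype.ext (Option.some.inj ((ha x p).symm.trans h))
  have ha_one : ∀ p, a 1 p = p := fun p => ha_eq 1 p p p.2
  have ha_mul : ∀ x y p, a (x * y) p = a y (a x p) := fun x y p =>
    ha_eq _ _ _ (by rw [hmul, ha x p]; exact ha y _)
  let act : MulAction G X :=
    { smul := fun x p => a x⁻¹ p
      one_smul := fun p => by change a 1⁻¹ p = p; rw [inv_one, ha_one]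
      mul_smul := fun x y p => by
        change a (x * y)⁻¹ p = a x⁻¹ (a y⁻¹ p)
        rw [mul_inv_rev, ha_mul] }
  have hsmul : ∀ (x : G) (p : X), x • p = a x⁻¹ p := fun _ _ => rfl
  -- outside the domain of `f 1` all elements of the group are undefined
  have hundef : ∀ x p, (f 1).1 p ≠ some p → (f x).1 p = none := by
    intro x p hp
    have h1 : (f 1).1 p = none := by
      by_contra h
      obtain ⟨p', hp'⟩ := Option.ne_none_iff_exists'.1 h
      exact hp (hdom p p' hp')
    have := hmul 1 x p
    rwa [one_mul, h1] at this
  choose L hL using h𝒜.connected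
  let g : X → FreeGroup A := fun p => FreeGroup.mk (L p.1)
  have hg : ∀ p : X, 𝒜.Reads 𝒜.base (g p) p.1 := fun p => ⟨_, rfl, hL p.1⟩
  have hginj : ∀ p p', g p * (g p')⁻¹ ∈ K → p = p' := by
    intro p p' h
    have h1 := (h𝒜.reads_base_iff.2 h).mul (hg p')
    rw [inv_mul_cancel_right] at h1
    exact Subtype.ext (h𝒜.reads_unique hd (hg p) h1)
  have hmem : ∀ x : G, MulAction.toPermHom G X x ∈ cosetPermGroup K g := by
    intro x
    obtain ⟨M, hM⟩ := hd.exists_path_of_mem (f x).2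
    refine ⟨FreeGroup.mk M, fun p => (h𝒜.reads_iff_coset (hg _) (hg p)).1
      ⟨M, rfl, (hM _ _).1 ?_⟩⟩
    have h1 : a x (x • p) = p := by rw [hsmul, ← ha_mul, inv_mul_cancel, ha_one]
    exact (ha x (x • p)).trans (congrArg (fun p : X => some p.1) h1)
  refine hH.of_injective ((MulAction.toPermHom G X).codRestrict _ hmem) ?_ (hK X g hginj)
  intro x y hxy
  have hxy' : ∀ p : X, x • p = y • p := fun p =>
    Equiv.congr_fun (congrArg Subtype.val hxy) p
  refine inv_injective (hf (Subtype.ext (funext fun p => ?_)))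
  by_cases hp : (f 1).1 p = some p
  · have := hxy' ⟨p, hp⟩
    rw [hsmul, hsmul] at this
    exact (ha x⁻¹ ⟨p, hp⟩).trans
      ((congrArg (fun p : X => some p.1) this).trans (ha y⁻¹ ⟨p, hp⟩).symm)
  · rw [hundef _ p hp, hundef _ p hp]

end BasedAutomaton

theorem mainTheorem1 {A : Type u} [Finite A] (H : ∀ (G : Type) [Group G], Prop)
    (hH : IsGroupPseudovariety H) (φ : FreeGroup A ≃* FreeGroup A) :
    IsStableUnder (fun M _ => GroupBar H M) φ := by
  intro K _ 𝒜 ℬ h𝒜 hℬ hM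
  exact hℬ.presents.groupBar hH hℬ.isDeterministic
    ((h𝒜.presents.cosetPermGroupsIn hH h𝒜.isDeterministic hM).map φ)
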